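/- Identify reals with elements of Cantor space $2^\omega$, and let $[\sigma]$ be the set of reals extending the finite binary string $\sigma$. Code Borel probability measures on $2^\omega$ by reals through a fixed computable surjection $\rho$ from $2^\omega$ onto the space of these measures, under which the codes of $\mu$ are, uniformly computably in both directions, equivalent to fast Cauchy names of $\mu$ (equivalently, to names giving arbitrarily good rational approximations of $\mu([\sigma])$ for all $\sigma$), and each $\rho^{-1}(\{\rho(R)\})$ is a $\Pi^0_1(R)$ class. A real $R$ with $\rho(R)=\mu$ is called a representation of $\mu$. For a representation $R$ of $\mu$ and a real $A$, an $(R,A)$-test is a sequence $(\mathcal V_n)_{n\in\mathbb N}$ of uniformly $\Sigma^0_1(R\oplus A)$ classes with $\mu(\mathcal V_n)\le 2^{-n}$ for all $n$. A real $X$ is $\mu$-random relative to $A$, written $X\in\mathrm{MLR}_\mu(A)$, if for some representation $R$ of $\mu$ one has $X\notin\bigcap_n\mathcal V_n$ for every $(R,A)$-test $(\mathcal V_n)$. Write $\mathrm{MLR}_\mu=\mathrm{MLR}_\mu(\emptyset)$, and extend this notion to measures on $2^\omega\times 2^\omega$ through the computable homeomorphism $(X,Y)\mapsto X\oplus Y$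 onto $2^\omega$. A real $X$ is an atom of $\mu$ if $\mu(\{X\})>0$. **Corollary.** Let $\mu$ be a Borel probability measure on $2^\omega$ and let $A,B\in 2^\omega$ with $A\ge_{\mathrm T}B$. If $(A,B)\in\mathrm{MLR}_{\mu\times\mu}$, then $B$ is an atom of $\mu$. Moreover, $B\in\mathrm{MLR}_\mu(A)$ if and only if $B$ is an atom of $\mu$. -/

import Mathlib

open MeasureTheory
open scoped ENNReal

namespace RelRandom

/-- Cantor space `2^ω`, with the product topology and its Borel (product) σ-algebra.
Its elements are called reals. -/
abbrev Cantor : Type := ℕ → Bool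

/-- The empty set, as a real. -/
def emptyReal : Cantor := fun _ => false

/-- The join `A ⊕ B`: `A` on the even positions, `B` on the odd ones. -/
def join (A B : Cantor) : Cantor :=
  fun n => if n % 2 = 0 then A (n / 2) else B (n / 2)

/-- The cylinder `[σ]` of all reals that extend the finite string `σ`. -/
def cylinder (σ : List Bool) : Set Cantor :=
  {X | ∀ (i : ℕ) (h : i < σ.length), X i = σ[i]}

/-- The characteristic function of a real, as an oracle. -/
def charFn (A : Cantor) : ℕ →. ℕ := fun n => Part.some (A n).toNat

/-- Turing reducibility of reals, `B ≤_T A`. -/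
def TuringLE (B A : Cantor) : Prop := TuringReducible (charFn B) (charFn A)

/-- A predicate is r.e. in the real `Z` if it is the domain of a function that is partial
recursive in `Z`. -/
def REIn {α : Type*} [Primcodable α] (Z : Cantor) (p : α → Prop) : Prop :=
  RecursiveIn {charFn Z} fun a => Part.assert (p a) fun _ => Part.some ()

/-- `V 0, V 1, …` are uniformly `Σ⁰₁(Z)` classes: there is a set `W` of pairs `(n, σ)`, r.e. in
`Z`, with `V n = ⋃ {[σ] : (n, σ) ∈ W}` for all `n`. -/
def UniformlySigmaOne (Z : Cantor) (V : ℕ → Set Cantor) : Prop :=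
  ∃ W : ℕ × List Bool → Prop, REIn Z W ∧
    ∀ n, V n = {X | ∃ σ, W (n, σ) ∧ X ∈ cylinder σ}

/-- The real number in `[0, 1]` whose name is the column of `R` with index `σ`. It is written in
base two with the redundant digits `0, 1, 2`, so that (unlike for ordinary binary expansions) one
can pass computably between such names and rapidly converging Cauchy sequences of rationals. Each
digit is the sum of two consecutive bits of the column. -/
noncomputable def columnValue (R : Cantor) (σ : List Bool) : ℝ :=
  ∑' k : ℕ, (((R (Nat.pair (Encodable.encode σ) (2 * k))).toNat : ℝ) +
    ((R (Nat.pair (Encodable.encode σ) (2 * k + 1))).toNat : ℝ)) / 2 ^ (k + 2)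

/-- `R` is a representation of the probability measure `μ`, that is, `ρ(R) = μ`, where
`ρ : 2^ω → 𝒫(2^ω)` is the following computable (hence continuous) map onto the space of Borel
probability measures: `ρ(R)` gives mass `1` to the whole space and divides the mass of `[σ]` by
giving `[σ0]` the mass that is named by the column `σ` of `R`, cut off at the mass of `[σ]`, and
`[σ1]` the rest. Thus `ρ(R)` is total and `ρ⁻¹({ρ(R)})` is a `Π⁰₁(R)` class (equality of all
cylinder masses). A representation of `μ` computes, uniformly, a fast Cauchy sequence of finite
rational combinations of Dirac measures that converges to `μ`, and conversely. -/
def IsRepresentation (R : Cantor) (μ : Measure Cantor) : Prop :=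
  IsProbabilityMeasure μ ∧
    ∀ σ : List Bool, μ.real (cylinder (σ ++ [false])) =
      min (columnValue R σ) (μ.real (cylinder σ))

/-- `V` is an `(R, A)`-test, for a representation `R` of `μ` and a real `A`. -/
structure IsTest (μ : Measure Cantor) (R A : Cantor) (V : ℕ → Set Cantor) : Prop where
  sigmaOne : UniformlySigmaOne (join R A) V
  measure_le : ∀ n, μ (V n) ≤ (2⁻¹ : ℝ≥0∞) ^ n

/-- `X` is `(R, A)`-random, where `R` is a representation of `μ`: it passes all
`(R, A)`-tests. -/
def IsRandom (μ : Measure Cantor) (R A X : Cantor) : Prop :=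
  ∀ V : ℕ → Set Cantor, IsTest μ R A V → X ∉ ⋂ n, V n

/-- `MLR_μ(A)`: the reals that are `μ`-random relative to `A`, that is, `(R, A)`-random for some
representation `R` of `μ`. -/
def MLR (μ : Measure Cantor) (A : Cantor) : Set Cantor :=
  {X | ∃ R, IsRepresentation R μ ∧ IsRandom μ R A X}

/-- `MLR_ν` for a measure `ν` on `2^ω × 2^ω`; the product is identified with `2^ω` through the
computable homeomorphism `(A, B) ↦ A ⊕ B`. -/
def pairMLR (ν : Measure (Cantor × Cantor)) : Set (Cantor × Cantor) :=
  {p | join p.1 p.2 ∈ MLR (ν.map fun q => join q.1 q.2) emptyReal}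

/-- `X` is an atom of `μ`. -/
def IsAtomOf (X : Cantor) (μ : Measure Cantor) : Prop := 0 < μ {X}

end RelRandom

namespace RelRandom

/-! Let `Φ` be a functional with `Φ^A = B`, and suppose `B` is not an atom. For a fixed oracle `X`,
the strings computed by `Φ^X` are pairwise compatible, even if `Φ^X` is partial. Those of mass below
`2⁻ⁿ` therefore all extend the shortest one among them, so the union of their cylinders has measure
at most `2⁻ⁿ` (`measure_le_of_compatible`).

With `X = A` this gives an `(R, A)`-test for any representation `R` of `μ`. It captures `B`, because
the cylinders around a non-atom have masses tending to `0`. For pairs, the class of all `X ⊕ Y` such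
that some initial segment of `Y` is computed by `Φ^X` and has mass below `2⁻ⁿ` has all its
`X`-sections of measure at most `2⁻ⁿ`, hence by Fubini it has measure at most `2⁻ⁿ` itself. Here
only a representation of the product is given, so the mass of `[σ]` is read off from that of `[σ] ×
[σ]`, which is its square.

Effectivity rests on two facts: a reduction amounts to a primitive recursive check on finite strings
(`TuringLE.exists_check`), and "the mass of `[σ]` is below `2⁻ⁿ`" is semidecidable from a
representation (`massCheck`, with soundness and completeness). Conversely, an atom cannot lie in
sets of arbitrarily small measure. -/

/-! ### Strings, initial segments and joins -/

/-- The initial segment of length `n` of a real. -/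
def pre (X : Cantor) (n : ℕ) : List Bool := (List.range n).map X

@[simp] theorem length_pre (X : Cantor) (n : ℕ) : (pre X n).length = n := by simp [pre]

theorem pre_succ (X : Cantor) (n : ℕ) : pre X (n + 1) = pre X n ++ [X n] := by
  simp [pre, List.range_succ]

theorem getElem?_pre (X : Cantor) {n i : ℕ} (h : i < n) : (pre X n)[i]? = some (X i) := by
  simp [pre, h]

theorem getD_pre (X : Cantor) {n i : ℕ} (h : i < n) : (pre X n).getD i false = X i := by
  simp [pre, h]

theorem take_pre (X : Cantor) {m n : ℕ} (h : m ≤ n) : (pre X n).take m = pre X m := by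
  rw [pre, ← List.map_take, List.take_range, min_eq_left h, pre]

theorem pre_prefix (X : Cantor) {m n : ℕ} (h : m ≤ n) : pre X m <+: pre X n := by
  rw [← take_pre X h]
  exact List.take_prefix _ _

theorem mem_cylinder_iff {X : Cantor} {σ : List Bool} : X ∈ cylinder σ ↔ pre X σ.length = σ := by
  refine ⟨fun h => List.ext_getElem (by simp) fun i h₁ h₂ => ?_, fun h i hi => ?_⟩
  · simpa [pre] using h i h₂
  · conv_rhs => rw [← List.getD_eq_getElem _ false hi, ← h, getD_pre X hi]

theorem mem_cylinder_pre {X Y : Cantor} {n : ℕ} :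
    X ∈ cylinder (pre Y n) ↔ ∀ i < n, X i = Y i := by
  simp [cylinder, pre]

/-- The bits of a string at the even positions. -/
def evens (s : List Bool) : List Bool :=
  (List.range (s.length / 2)).map fun i => s.getD (2 * i) false

/-- The bits of a string at the odd positions. -/
def odds (s : List Bool) : List Bool :=
  (List.range (s.length / 2)).map fun i => s.getD (2 * i + 1) false

/-- Every bit of a string, twice. -/
def dbl (s : List Bool) : List Bool :=
  (List.range (2 * s.length)).map fun i => s.getD (i / 2) false

theorem join_even (A B : Cantor) (i : ℕ) : join A B (2 * i) = A i := by simp [join]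

theorem join_odd (A B : Cantor) (i : ℕ) : join A B (2 * i + 1) = B i := by
  simp only [join, show (2 * i + 1) % 2 ≠ 0 by omega, if_false]
  congr 1
  omega

theorem evens_pre (A B : Cantor) (n : ℕ) : evens (pre (join A B) n) = pre A (n / 2) := by
  rw [evens, length_pre, pre.eq_def A]
  refine List.map_congr_left fun i hi => ?_
  rw [List.mem_range] at hi
  rw [getD_pre _ (by omega), join_even]

theorem odds_pre (A B : Cantor) (n : ℕ) : odds (pre (join A B) n) = pre B (n / 2) := by
  rw [odds, length_pre, pre.eq_def B]
  refine List.map_congr_left fun i hi => ?_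
  rw [List.mem_range] at hi
  rw [getD_pre _ (by omega), join_odd]

/-- Under the join homeomorphism the square `[σ] × [σ]` is thus a single cylinder, whose mass a
representation of the product measure provides. -/
theorem dbl_pre (A : Cantor) (n : ℕ) : dbl (pre A n) = pre (join A A) (2 * n) := by
  rw [dbl, length_pre, pre.eq_def (join A A)]
  refine List.map_congr_left fun i hi => ?_
  rw [List.mem_range] at hi
  rw [getD_pre _ (by omega), join, ite_self]

section Primrec
open Primrec

theorem primrec_evens : Primrec evens := by
  refine list_map (list_range.comp (nat_div.comp list_length (const 2))) ?_
  exact (list_getD false).comp fst (nat_mul.comp (const 2) snd)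

theorem primrec_odds : Primrec odds := by
  refine list_map (list_range.comp (nat_div.comp list_length (const 2))) ?_
  exact (list_getD false).comp fst (succ.comp (nat_mul.comp (const 2) snd))

theorem primrec_dbl : Primrec dbl := by
  refine list_map (list_range.comp (nat_mul.comp (const 2) list_length)) ?_
  exact (list_getD false).comp fst (nat_div.comp snd (const 2))

end Primrec

/-! ### R.e. predicates from checks on oracle strings -/

section Oracle

/-- The initial segments of an oracle can be computed from it. -/
theorem recursiveIn_pre (Z : Cantor) :
    Nat.RecursiveIn {charFn Z} fun n => Part.some (Encodable.encode (pre Z n)) := by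
  have hstep : Nat.Primrec fun p : ℕ => Encodable.encode
      (((Encodable.decode (α := List Bool) p.unpair.1).getD []) ++ [decide (p.unpair.2 ≠ 0)]) := by
    rw [← Primrec.nat_iff]
    refine Primrec.encode.comp (Primrec.list_append.comp
      (Primrec.option_getD.comp (Primrec.decode.comp (Primrec.fst.comp Primrec.unpair))
        (Primrec.const _)) (Primrec.list_cons.comp ?_ (Primrec.const _)))
    exact (PrimrecPred.not (Primrec.eq.comp (Primrec.snd.comp Primrec.unpair)
      (Primrec.const 0))).decide
  have hmain := Nat.RecursiveIn.prec (O := {charFn Z})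
    (Nat.Primrec.recursiveIn (Nat.Primrec.const (Encodable.encode ([] : List Bool))))
    (Nat.RecursiveIn.comp (Nat.Primrec.recursiveIn hstep) (Nat.RecursiveIn.pair
      (Nat.RecursiveIn.comp .right .right)
      (Nat.RecursiveIn.comp (.oracle _ (Set.mem_singleton (charFn Z)))
        (Nat.RecursiveIn.comp .left .right))))
  refine Nat.RecursiveIn.of_eq (Nat.RecursiveIn.comp hmain (Nat.Primrec.recursiveIn
    (Nat.Primrec.pair (Nat.Primrec.const 0) Nat.Primrec.id))) fun n => ?_
  simp only [Part.coe_some, Part.bind_eq_bind, Part.bind_some, Nat.unpair_pair]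
  induction n with
  | zero => simp [pre]
  | succ n ih =>
    have ih' := ih
    simp only [id] at ih' ⊢
    have horacle : (Part.some n >>= charFn Z) = Part.some (Z n).toNat := Part.bind_some _ _
    rw [ih']
    cases hZ : Z n <;> simp [horacle, pre_succ, Seq.seq, hZ]

/-- A predicate is r.e. in `Z` if it says that some `k` passes a primitive recursive check that
reads a primitive recursively bounded initial segment of `Z`. -/
theorem reIn_of_exists {α : Type*} [Primcodable α] (Z : Cantor) {p : α → Prop}
    {h : α × ℕ → ℕ} {Q : List Bool × α × ℕ → Bool} (hh : Primrec h) (hQ : Primrec Q)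
    (hp : ∀ a, p a ↔ ∃ k, Q (pre Z (h (a, k)), a, k) = true) : REIn Z p := by
  have hh' : Nat.Primrec fun q : ℕ =>
      ((Encodable.decode (α := α) q.unpair.1).map fun a => h (a, q.unpair.2)).getD 0 := by
    rw [← Primrec.nat_iff]
    refine Primrec.option_getD.comp (Primrec.option_map
      (Primrec.decode.comp (Primrec.fst.comp Primrec.unpair)) ?_) (Primrec.const 0)
    exact hh.comp (Primrec.pair Primrec.snd
      (Primrec.snd.comp (Primrec.unpair.comp Primrec.fst)))
  -- The check is negated because `rfind` searches for a zero. The default `false` makes the search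
  -- diverge on inputs that code no element of `α`.
  have hg : Nat.Primrec fun q : ℕ => 1 - (((Encodable.decode (α := α) q.unpair.1.unpair.1).map
      fun a => Q ((Encodable.decode (α := List Bool) q.unpair.2).getD [], a,
        q.unpair.1.unpair.2)).getD false).toNat := by
    rw [← Primrec.nat_iff]
    have h1 : Primrec fun q : ℕ => q.unpair.1.unpair :=
      Primrec.unpair.comp (Primrec.fst.comp Primrec.unpair)
    refine Primrec.nat_sub.comp (Primrec.const 1) ((Primrec.dom_finite Bool.toNat).comp
      (Primrec.option_getD.comp (Primrec.option_map
        (Primrec.decode.comp (Primrec.fst.comp h1)) ?_) (Primrec.const false)))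
    refine hQ.comp (Primrec.pair ?_ (Primrec.pair Primrec.snd
      (Primrec.snd.comp (h1.comp Primrec.fst))))
    exact Primrec.option_getD.comp (Primrec.decode.comp (Primrec.snd.comp
      (Primrec.unpair.comp Primrec.fst))) (Primrec.const _)
  -- The witness found by the search is replaced by `0`, the code of `()`.
  have hmain := Nat.RecursiveIn.comp (O := {charFn Z})
    (Nat.Primrec.recursiveIn (Nat.Primrec.const 0)) (Nat.RecursiveIn.rfind
      (Nat.RecursiveIn.comp (Nat.Primrec.recursiveIn hg)
        (Nat.RecursiveIn.pair (Nat.Primrec.recursiveIn Nat.Primrec.id)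
          (Nat.RecursiveIn.comp (recursiveIn_pre Z) (Nat.Primrec.recursiveIn hh')))))
  refine Nat.RecursiveIn.of_eq hmain fun n => ?_
  simp only [Part.coe_some, Part.bind_eq_bind, Part.bind_some, Seq.seq, Part.map_eq_map,
    Part.map_some, id, Nat.unpair_pair, Encodable.encodek, Option.getD_some]
  rcases hd : Encodable.decode (α := α) n with _ | a
  · ext b
    suffices ∀ k ∈ Nat.rfind fun _ => Part.some false, b ≠ 0 by simpa [Part.mem_bind_iff]
    intro k hk
    simpa using Nat.rfind_spec hk
  · ext b
    simp only [Part.mem_bind_iff, Option.map_some, Option.getD_some, Part.coe_some, Part.bind_some,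
      Part.mem_map_iff, Part.mem_assert_iff, Part.mem_some_iff, hp]
    constructor
    · rintro ⟨k, hk, rfl⟩
      have := Nat.rfind_spec hk
      refine ⟨(), ⟨⟨k, ?_⟩, trivial⟩, rfl⟩
      cases hq : Q (pre Z (h (a, k)), a, k) <;> simp_all
    · rintro ⟨_, ⟨⟨k, hk⟩, -⟩, rfl⟩
      obtain ⟨m, hm, -⟩ := Nat.rfind_min' (p := fun k =>
        decide (1 - (Q (pre Z (h (a, k)), a, k)).toNat = 0)) (m := k) (by simp [hk])
      exact ⟨m, hm, rfl⟩

end Oracle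

/-! ### The use principle and Turing reductions -/

/-- Use principle: a function recursive in `A` is the limit, along the initial segments of `A`, of
a partial recursive function that is monotone in its string argument. -/
theorem exists_partrec_of_recursiveIn {A : Cantor} {f : ℕ →. ℕ}
    (hf : Nat.RecursiveIn {charFn A} f) :
    ∃ φ : List Bool → ℕ →. ℕ, Partrec₂ φ ∧
      (∀ s t a b, s <+: t → b ∈ φ s a → b ∈ φ t a) ∧
      ∀ a b, b ∈ f a → ∀ᶠ n in Filter.atTop, b ∈ φ (pre A n) a := by
  have lift : ∀ {f : ℕ →. ℕ}, Nat.Partrec f → ∃ φ : List Bool → ℕ →. ℕ, Partrec₂ φ ∧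
      (∀ s t a b, s <+: t → b ∈ φ s a → b ∈ φ t a) ∧
      ∀ a b, b ∈ f a → ∀ᶠ n in Filter.atTop, b ∈ φ (pre A n) a := fun {f} hf =>
    ⟨fun _ => f, (Partrec.nat_iff.2 hf).comp Computable.snd, fun _ _ _ _ _ h => h,
      fun _ _ h => Filter.Eventually.of_forall fun _ => h⟩
  induction hf with
  | zero => exact lift .zero
  | succ => exact lift .succ
  | left => exact lift .left
  | right => exact lift .right
  | oracle g hg =>
    rw [Set.mem_singleton_iff] at hg
    subst hg
    -- A query beyond the end of the string diverges; a default answer would destroy monotonicity.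
    refine ⟨fun s i => (((s[i]?).map Bool.toNat : Option ℕ) : Part ℕ), ?_, ?_, ?_⟩
    · exact Computable.ofOption (Computable.option_map Computable.list_getElem?
        ((Primrec.dom_finite Bool.toNat).to_comp.comp Computable.snd))
    · rintro s _ a b ⟨t, rfl⟩ h
      simp only [Part.mem_coe, Option.mem_def, Option.map_eq_some_iff] at h ⊢
      obtain ⟨c, hc, rfl⟩ := h
      obtain ⟨ha, -⟩ := List.getElem?_eq_some_iff.1 hc
      exact ⟨c, by rw [List.getElem?_append_left ha, hc], rfl⟩
    · intro a b h
      have hb : b = (A a).toNat := Part.mem_some_iff.1 h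
      filter_upwards [Filter.eventually_gt_atTop a] with n hn
      simp [getElem?_pre A hn, hb]
  | @pair f h _ _ ihf ihh =>
    obtain ⟨φ, hφ, mφ, cφ⟩ := ihf
    obtain ⟨χ, hχ, mχ, cχ⟩ := ihh
    refine ⟨fun s a => (φ s a).bind fun x => (χ s a).map fun y => Nat.pair x y, ?_, ?_, ?_⟩
    · refine Partrec.bind hφ (Partrec.map (Partrec₂.comp hχ
        (Computable.fst.comp Computable.fst) (Computable.snd.comp Computable.fst)) ?_)
      exact Primrec₂.natPair.to_comp.comp (Computable.snd.comp Computable.fst) Computable.snd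
    · intro s t a b hst h
      simp only [Part.mem_bind_iff, Part.mem_map_iff] at h ⊢
      obtain ⟨x, hx, y, hy, rfl⟩ := h
      exact ⟨x, mφ _ _ _ _ hst hx, y, mχ _ _ _ _ hst hy, rfl⟩
    · intro a b h
      simp only [Seq.seq, Part.map_eq_map, Part.mem_bind_iff, Part.mem_map_iff] at h
      obtain ⟨_, ⟨x, hx, rfl⟩, y, hy, rfl⟩ := h
      filter_upwards [cφ _ _ hx, cχ _ _ hy] with n h1 h2
      simp only [Part.mem_bind_iff, Part.mem_map_iff]
      exact ⟨x, h1, y, h2, rfl⟩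
  | @comp f h _ _ ihf ihh =>
    obtain ⟨φ, hφ, mφ, cφ⟩ := ihf
    obtain ⟨χ, hχ, mχ, cχ⟩ := ihh
    refine ⟨fun s a => (χ s a).bind fun x => φ s x, ?_, ?_, ?_⟩
    · exact Partrec.bind hχ (Partrec₂.comp hφ (Computable.fst.comp Computable.fst) Computable.snd)
    · intro s t a b hst h
      rw [Part.mem_bind_iff] at h ⊢
      obtain ⟨x, hx, hb⟩ := h
      exact ⟨x, mχ _ _ _ _ hst hx, mφ _ _ _ _ hst hb⟩
    · intro a b h
      obtain ⟨x, hx, hb⟩ := Part.mem_bind_iff.1 h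
      filter_upwards [cχ _ _ hx, cφ _ _ hb] with n h1 h2
      exact Part.mem_bind_iff.2 ⟨x, h1, h2⟩
  | @prec f h _ _ ihf ihh =>
    obtain ⟨φ, hφ, mφ, cφ⟩ := ihf
    obtain ⟨χ, hχ, mχ, cχ⟩ := ihh
    refine ⟨fun s p => Nat.rec (φ s p.unpair.1)
      (fun y IH => IH.bind fun i => χ s (Nat.pair p.unpair.1 (Nat.pair y i))) p.unpair.2,
      ?_, ?_, ?_⟩
    · have hu : Primrec fun q : List Bool × ℕ => q.2.unpair := Primrec.unpair.comp Primrec.snd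
      have harg : Primrec fun x : (List Bool × ℕ) × ℕ × ℕ =>
          Nat.pair x.1.2.unpair.1 (Nat.pair x.2.1 x.2.2) :=
        Primrec₂.natPair.comp (Primrec.fst.comp (hu.comp Primrec.fst))
          (Primrec₂.natPair.comp (Primrec.fst.comp Primrec.snd) (Primrec.snd.comp Primrec.snd))
      have hbase : Partrec fun q : List Bool × ℕ => φ q.1 q.2.unpair.1 :=
        Partrec₂.comp hφ Computable.fst (Primrec.fst.comp hu).to_comp
      have hstep : Partrec₂ fun (q : List Bool × ℕ) (z : ℕ × ℕ) =>
          χ q.1 (Nat.pair q.2.unpair.1 (Nat.pair z.1 z.2)) :=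
        Partrec₂.comp hχ (Primrec.fst.comp Primrec.fst).to_comp harg.to_comp
      exact Partrec.nat_rec (Primrec.snd.comp hu).to_comp hbase hstep
    · intro s t p b hst
      beta_reduce
      generalize p.unpair.1 = a
      generalize p.unpair.2 = n
      induction n generalizing b with
      | zero => exact fun h => mφ s t a b hst h
      | succ n ih =>
        intro (h : b ∈ Part.bind _ _)
        obtain ⟨i, hi, hb⟩ := Part.mem_bind_iff.1 h
        exact Part.mem_bind_iff.2 ⟨i, ih _ hi, mχ _ _ _ _ hst hb⟩
    · intro p b
      simp only
      generalize p.unpair.1 = a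
      generalize p.unpair.2 = n
      induction n generalizing b with
      | zero => exact cφ _ _
      | succ n ih =>
        intro h
        obtain ⟨i, hi, hb⟩ := Part.mem_bind_iff.1 h
        filter_upwards [ih _ hi, cχ _ _ hb] with m h1 h2
        exact Part.mem_bind_iff.2 ⟨i, h1, h2⟩
  | @rfind f _ ihf =>
    obtain ⟨φ, hφ, mφ, cφ⟩ := ihf
    refine ⟨fun s a => Nat.rfind fun n => (φ s (Nat.pair a n)).map fun m => decide (m = 0),
      ?_, ?_, ?_⟩
    · refine Partrec.rfind (Partrec.map (Partrec₂.comp hφ (Computable.fst.comp Computable.fst)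
        (Primrec₂.natPair.to_comp.comp (Computable.snd.comp Computable.fst) Computable.snd)) ?_)
      exact (Primrec.eq.comp Primrec.snd (Primrec.const 0)).decide.to_comp
    · intro s t a b hst h
      have hm : ∀ {m : ℕ} {c : Bool}, c ∈ (φ s (Nat.pair a m)).map (fun m => decide (m = 0)) →
          c ∈ (φ t (Nat.pair a m)).map (fun m => decide (m = 0)) := by
        intro m c hc
        obtain ⟨x, hx, rfl⟩ := (Part.mem_map_iff _).1 hc
        exact Part.mem_map _ (mφ _ _ _ _ hst hx)
      have h := Nat.mem_rfind.1 h
      exact Nat.mem_rfind.2 ⟨hm h.1, fun hlt => hm (h.2 hlt)⟩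
    · intro a b h
      have hm : ∀ {m : ℕ} {c : Bool}, c ∈ (f (Nat.pair a m)).map (fun m => decide (m = 0)) →
          ∀ᶠ n in Filter.atTop,
            c ∈ (φ (pre A n) (Nat.pair a m)).map (fun m => decide (m = 0)) := by
        intro m c hc
        obtain ⟨x, hx, rfl⟩ := (Part.mem_map_iff _).1 hc
        filter_upwards [cφ _ _ hx] with n hn
        exact Part.mem_map _ hn
      have h := Nat.mem_rfind.1 h
      -- A successful search consults only finitely many values, so one initial segment of the
      -- oracle serves them all.
      have hall := ((Set.finite_lt_nat b).eventually_all (l := Filter.atTop)).2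
        fun m hlt => hm (h.2 hlt)
      filter_upwards [hm h.1, hall] with n h1 h2
      exact Nat.mem_rfind.2 ⟨h1, fun {m} hlt => h2 m hlt⟩

/-- A Turing reduction of `B` to `A` as a primitive recursive check `C`, where `C (s, k, τ)` says
that within `k` steps the functional computes the initial segment `τ` from the oracle string `s`. -/
theorem TuringLE.exists_check {A B : Cantor} (h : TuringLE B A) :
    ∃ C : List Bool × ℕ × List Bool → Bool, Primrec C ∧
      (∀ X Y Y' n n' k k' m m', C (pre X n, k, pre Y m) = true →
        C (pre X n', k', pre Y' m') = true → ∀ i, i < m → i < m' → Y i = Y' i) ∧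
      ∀ m, ∃ n ≥ m, ∀ᶠ k in Filter.atTop, C (pre A n, k, pre B m) = true := by
  obtain ⟨φ, hφ, mφ, cφ⟩ := exists_partrec_of_recursiveIn (RecursiveIn.iff_nat.1 h)
  obtain ⟨c, hc⟩ := Nat.Partrec.Code.exists_code.1 hφ
  have hev : ∀ s i, c.eval (Encodable.encode (s, i)) = φ s i := by
    intro s i
    simp [hc, Part.map_id']
  have hsound : ∀ {k s i b}, c.evaln k (Encodable.encode ((s : List Bool), (i : ℕ))) = some b →
      b ∈ φ s i := fun hb => by
    rw [← hev]
    exact Nat.Partrec.Code.evaln_sound hb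
  refine ⟨fun q => decide (∀ i < q.2.2.length,
    c.evaln q.2.1 (Encodable.encode (q.1, i)) = some (q.2.2.getD i false).toNat), ?_, ?_, ?_⟩
  · have hR : PrimrecRel fun (i : ℕ) (q : List Bool × ℕ × List Bool) =>
        c.evaln q.2.1 (Encodable.encode (q.1, i)) = some (q.2.2.getD i false).toNat := by
      refine Primrec.eq.comp (Nat.Partrec.Code.primrec_evaln.comp (Primrec.pair (Primrec.pair
        (Primrec.fst.comp (Primrec.snd.comp Primrec.snd)) (Primrec.const c))
        (Primrec.encode.comp (Primrec.pair (Primrec.fst.comp Primrec.snd) Primrec.fst)))) ?_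
      exact Primrec.option_some.comp ((Primrec.dom_finite Bool.toNat).comp
        ((Primrec.list_getD false).comp
          (Primrec.snd.comp (Primrec.snd.comp Primrec.snd)) Primrec.fst))
    have hlen : Primrec fun q : List Bool × ℕ × List Bool => List.range q.2.2.length :=
      Primrec.list_range.comp (Primrec.list_length.comp (Primrec.snd.comp Primrec.snd))
    exact (hR.forall_mem_list.comp hlen Primrec.id).decide.of_eq fun q => by simp
  · intro X Y Y' n n' k k' m m' h1 h2 i hi hi'
    simp only [length_pre, decide_eq_true_eq] at h1 h2
    have h1 := hsound (h1 i hi)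
    have h2 := hsound (h2 i hi')
    rw [getD_pre _ hi] at h1
    rw [getD_pre _ hi'] at h2
    -- By monotonicity both computations survive on the longer of the two initial segments of `X`,
    -- where values are unique.
    have := Part.mem_unique (mφ _ _ _ _ (pre_prefix X (le_max_left n n')) h1)
      (mφ _ _ _ _ (pre_prefix X (le_max_right n n')) h2)
    cases hY : Y i <;> cases hY' : Y' i <;> simp_all
  · intro m
    have hall := ((Set.finite_lt_nat m).eventually_all (l := Filter.atTop)).2
      fun i (_ : i < m) => cφ i (B i).toNat (Part.mem_some _)
    -- Asking for `m ≤ n` lets the pair test use one string `pre (join A B) (2 * n)` that contains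
    -- both the oracle part and `pre B m`.
    obtain ⟨n, hn, hmn⟩ := (hall.and (Filter.eventually_ge_atTop m)).exists
    refine ⟨n, hmn, ?_⟩
    have hk := ((Set.finite_lt_nat m).eventually_all (l := Filter.atTop)).2
      fun i (hi : i < m) => show ∀ᶠ k in Filter.atTop,
        c.evaln k (Encodable.encode (pre A n, i)) = some (B i).toNat by
          obtain ⟨k, hk⟩ := Nat.Partrec.Code.evaln_complete.1 ((hev _ _).symm ▸ hn i hi)
          filter_upwards [Filter.eventually_ge_atTop k] with k' hk'
          exact Nat.Partrec.Code.evaln_mono hk' hk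
    filter_upwards [hk] with k hk
    simp only [length_pre, decide_eq_true_eq]
    intro i hi
    rw [getD_pre _ hi]
    exact hk i hi

/-! ### Computing cylinder masses from a representation -/

/-- The first `k` digits of the column `τ` of `g`, as an integer multiple of `2 ^ (-(k + 1))`. -/
def mant (g : Cantor) (τ : List Bool) : ℕ → ℕ
  | 0 => 0
  | k + 1 => 2 * mant g τ k + ((g (Nat.pair (Encodable.encode τ) (2 * k))).toNat +
      (g (Nat.pair (Encodable.encode τ) (2 * k + 1))).toNat)

/-- The mass of the cylinder of the first `i` bits of `σ`, computed from `k` digits of the columns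
of `g`, as an integer multiple of `2 ^ (-(k + 1))`. -/
def massApprox (g : Cantor) (k : ℕ) (σ : List Bool) : ℕ → ℕ
  | 0 => 2 ^ (k + 1)
  | i + 1 => if σ.getD i false = true then massApprox g k σ i - mant g (σ.take i) k
      else min (mant g (σ.take i) k) (massApprox g k σ i)

/-- The string `s`, read as part of a representation, shows with precision `k` that the mass of
`[σ]` is less than `2 ^ (-n)`. -/
def massCheck (s : List Bool) (σ : List Bool) (n k : ℕ) : Bool :=
  decide ((massApprox (fun i => s.getD i false) k σ σ.length + 2 * σ.length) * 2 ^ n < 2 ^ (k + 1))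

section Primrec
open Primrec

theorem primrec_two_pow : Primrec fun n : ℕ => 2 ^ n :=
  (nat_rec₁ 1 (f := fun _ m => 2 * m) (nat_mul.comp (const 2) snd)).of_eq fun n => by
    induction n with
    | zero => rfl
    | succ n ih => rw [pow_succ', ← ih]

theorem primrec_mant :
    Primrec fun q : List Bool × List Bool × ℕ => mant (fun i => q.1.getD i false) q.2.1 q.2.2 := by
  have hlook : ∀ c, Primrec fun x : (List Bool × List Bool × ℕ) × ℕ × ℕ =>
      (x.1.1.getD (Nat.pair (Encodable.encode x.1.2.1) (2 * x.2.1 + c)) false).toNat := fun c =>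
    (dom_finite Bool.toNat).comp ((list_getD false).comp (fst.comp fst)
      (Primrec₂.natPair.comp (Primrec.encode.comp (fst.comp (snd.comp fst)))
        (nat_add.comp (nat_mul.comp (const 2) (fst.comp snd)) (const c))))
  have hstep : Primrec₂ fun (q : List Bool × List Bool × ℕ) (z : ℕ × ℕ) => 2 * z.2 +
      ((q.1.getD (Nat.pair (Encodable.encode q.2.1) (2 * z.1 + 0)) false).toNat +
        (q.1.getD (Nat.pair (Encodable.encode q.2.1) (2 * z.1 + 1)) false).toNat) :=
    nat_add.comp (nat_mul.comp (const 2) (snd.comp snd)) (nat_add.comp (hlook 0) (hlook 1))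
  refine (nat_rec' (snd.comp snd) (const 0) hstep).of_eq fun q => ?_
  generalize q.2.2 = k
  induction k with
  | zero => rfl
  | succ k ih => simp only [mant, ← ih, Nat.add_zero]

theorem primrec_massCheck : Primrec fun q : List Bool × List Bool × ℕ × ℕ =>
    massCheck q.1 q.2.1 q.2.2.1 q.2.2.2 := by
  have hσ : Primrec fun q : List Bool × List Bool × ℕ × ℕ => q.2.1 := fst.comp snd
  have hk : Primrec fun q : List Bool × List Bool × ℕ × ℕ => 2 ^ (q.2.2.2 + 1) :=
    primrec_two_pow.comp (succ.comp (snd.comp (snd.comp snd)))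
  have hmant : Primrec fun x : (List Bool × List Bool × ℕ × ℕ) × ℕ × ℕ =>
      mant (fun i => x.1.1.getD i false) (x.1.2.1.take x.2.1) x.1.2.2.2 :=
    primrec_mant.comp (Primrec.pair (fst.comp fst) (Primrec.pair
      (list_take.comp (fst.comp snd) (hσ.comp fst)) (snd.comp (snd.comp (snd.comp fst)))))
  have hstep : Primrec₂ fun (q : List Bool × List Bool × ℕ × ℕ) (z : ℕ × ℕ) =>
      if q.2.1.getD z.1 false = true then
        z.2 - mant (fun i => q.1.getD i false) (q.2.1.take z.1) q.2.2.2
      else min (mant (fun i => q.1.getD i false) (q.2.1.take z.1) q.2.2.2) z.2 :=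
    Primrec.ite (Primrec.eq.comp ((list_getD false).comp (hσ.comp fst) (fst.comp snd))
      (const true)) (nat_sub.comp (snd.comp snd) hmant) (nat_min.comp hmant (snd.comp snd))
  have happrox : Primrec fun q : List Bool × List Bool × ℕ × ℕ =>
      massApprox (fun i => q.1.getD i false) q.2.2.2 q.2.1 q.2.1.length := by
    refine (nat_rec' (list_length.comp hσ) hk hstep).of_eq fun q => ?_
    generalize q.2.1.length = l
    induction l with
    | zero => rfl
    | succ l ih => simp only [massApprox, ← ih]
  exact (nat_lt.comp (nat_mul.comp (nat_add.comp happrox (nat_mul.comp (const 2)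
    (list_length.comp hσ))) (primrec_two_pow.comp (fst.comp (snd.comp snd)))) hk).decide

theorem primrec_massCheck_comp {α : Type*} [Primcodable α] {s σ : α → List Bool} {n k : α → ℕ}
    (hs : Primrec s) (hσ : Primrec σ) (hn : Primrec n) (hk : Primrec k) :
    Primrec fun a => massCheck (s a) (σ a) (n a) (k a) :=
  primrec_massCheck.comp (hs.pair (hσ.pair (hn.pair hk)))

end Primrec

/-- This bounds the use: the columns of all prefixes of `σ` are read below the position given by the
code of `σ` itself. -/
theorem encode_le_of_prefix {s t : List Bool} (h : s <+: t) :
    Encodable.encode s ≤ Encodable.encode t := by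
  obtain ⟨u, rfl⟩ := h
  induction s with
  | nil => simp
  | cons a s ih =>
    rw [List.cons_append, Encodable.encode_list_cons, Encodable.encode_list_cons]
    refine Nat.succ_le_succ ?_
    rcases ih.eq_or_lt with h | h
    · rw [h]
    · exact (Nat.pair_lt_pair_right _ h).le

theorem mant_congr {g g' : Cantor} {τ : List Bool} {k : ℕ}
    (h : ∀ j < 2 * k, g (Nat.pair (Encodable.encode τ) j) = g' (Nat.pair (Encodable.encode τ) j)) :
    mant g τ k = mant g' τ k := by
  induction k with
  | zero => rfl
  | succ k ih =>
    rw [mant, mant, ih fun j hj => h j (by omega), h _ (by omega), h _ (by omega)]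

theorem massApprox_congr {g g' : Cantor} {σ : List Bool} {k : ℕ}
    (h : ∀ j < Nat.pair (Encodable.encode σ) (2 * k), g j = g' j) (i : ℕ) :
    massApprox g k σ i = massApprox g' k σ i := by
  induction i with
  | zero => rfl
  | succ i ih =>
    have hm : mant g (σ.take i) k = mant g' (σ.take i) k := mant_congr fun j hj => h _ <| by
      rcases (encode_le_of_prefix (List.take_prefix i σ)).eq_or_lt with he | he
      · rw [he]
        exact Nat.pair_lt_pair_right _ hj
      · exact (Nat.pair_lt_pair_left _ he).trans (Nat.pair_lt_pair_right _ hj)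
    rw [massApprox, massApprox, ih, hm]

theorem massCheck_pre {R : Cantor} {σ : List Bool} {n k L : ℕ}
    (hL : Nat.pair (Encodable.encode σ) (2 * k) ≤ L) :
    massCheck (pre R L) σ n k = true ↔
      (massApprox R k σ σ.length + 2 * σ.length) * 2 ^ n < 2 ^ (k + 1) := by
  rw [massCheck, decide_eq_true_eq,
    massApprox_congr (g' := R) fun j hj => getD_pre R (hj.trans_le hL)]

/-- Digits are at most `2`, so the tail after `k` digits is at most `2 / 2 ^ (k + 1)`, that is, `2`
units of the scale of `mant`. -/
theorem mant_le_columnValue (R : Cantor) (τ : List Bool) (k : ℕ) :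
    (mant R τ k : ℝ) ≤ 2 ^ (k + 1) * columnValue R τ ∧
      2 ^ (k + 1) * columnValue R τ ≤ mant R τ k + 2 := by
  set d : ℕ → ℝ := fun j => (((R (Nat.pair (Encodable.encode τ) (2 * j))).toNat : ℝ) +
    ((R (Nat.pair (Encodable.encode τ) (2 * j + 1))).toNat : ℝ)) / 2 ^ (j + 2) with hd
  have hbit : ∀ b : Bool, ((b.toNat : ℕ) : ℝ) ≤ 1 := fun b => by cases b <;> simp
  have hnn : ∀ j, 0 ≤ d j := fun j => by positivity
  have hle : ∀ k j, d (j + k) ≤ 2 / 2 ^ (k + 1) / 2 / 2 ^ j := fun k j => by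
    rw [hd, show (2 : ℝ) / 2 ^ (k + 1) / 2 / 2 ^ j = 2 / 2 ^ (j + k + 2) by
      rw [div_div, div_div]; ring_nf]
    beta_reduce
    gcongr
    linarith [hbit (R (Nat.pair (Encodable.encode τ) (2 * (j + k)))),
      hbit (R (Nat.pair (Encodable.encode τ) (2 * (j + k) + 1)))]
  have hs : Summable d :=
    Summable.of_nonneg_of_le hnn (hle 0) (hasSum_geometric_two' _).summable
  have hfin : ∀ k, 2 ^ (k + 1) * ∑ j ∈ Finset.range k, d j = mant R τ k := fun k => by
    induction k with
    | zero => simp [mant]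
    | succ k ih =>
      rw [Finset.sum_range_succ, mul_add, pow_succ, mul_right_comm, ih, mant, hd]
      push_cast
      field_simp
      ring
  have hcv : columnValue R τ = ∑ j ∈ Finset.range k, d j + ∑' j, d (j + k) :=
    (hs.sum_add_tsum_nat_add k).symm
  have htail : ∑' j, d (j + k) ≤ 2 / 2 ^ (k + 1) :=
    (((summable_nat_add_iff k).2 hs).tsum_le_tsum (hle k)
      (hasSum_geometric_two' _).summable).trans_eq (hasSum_geometric_two' _).tsum_eq
  rw [hcv, mul_add, hfin]
  have hp : (0 : ℝ) < 2 ^ (k + 1) := by positivity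
  refine ⟨le_add_of_nonneg_right (mul_nonneg hp.le (tsum_nonneg fun j => hnn _)), ?_⟩
  rw [le_div_iff₀ hp] at htail
  linarith

theorem measurableSet_cylinder (σ : List Bool) : MeasurableSet (cylinder σ) := by
  have : cylinder σ = ⋂ (i : ℕ) (h : i < σ.length), (fun X : Cantor => X i) ⁻¹' {σ[i]} := by
    ext X
    simp [cylinder]
  rw [this]
  exact MeasurableSet.iInter fun i => MeasurableSet.iInter fun h =>
    measurable_pi_apply i (measurableSet_singleton _)

theorem cylinder_nil : cylinder [] = Set.univ := by
  ext X
  simp [cylinder]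

theorem mem_cylinder_concat {X : Cantor} {σ : List Bool} {b : Bool} :
    X ∈ cylinder (σ ++ [b]) ↔ X ∈ cylinder σ ∧ X σ.length = b := by
  rw [mem_cylinder_iff, mem_cylinder_iff, List.length_append, List.length_singleton, pre_succ]
  exact ⟨fun h => by simpa using List.append_inj' h rfl, fun h => by rw [h.1, h.2]⟩

theorem measureReal_cylinder_true (μ : Measure Cantor) [IsProbabilityMeasure μ] (σ : List Bool) :
    μ.real (cylinder (σ ++ [true])) =
      μ.real (cylinder σ) - μ.real (cylinder (σ ++ [false])) := by
  have hu : cylinder σ = cylinder (σ ++ [false]) ∪ cylinder (σ ++ [true]) := by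
    ext X
    simp only [Set.mem_union, mem_cylinder_concat]
    cases X σ.length <;> simp
  have hdj : Disjoint (cylinder (σ ++ [false])) (cylinder (σ ++ [true])) := by
    refine Set.disjoint_left.2 fun X h1 h2 => ?_
    rw [mem_cylinder_concat] at h1 h2
    simpa [h1.2] using h2.2
  rw [hu, measureReal_union hdj (measurableSet_cylinder _)]
  ring

/-- Each bit of `σ` brings in one column value, known up to `2` units. Taking a minimum or a
truncated difference adds no error beyond the sum of the errors of its arguments. -/
theorem abs_massApprox_sub_le {R : Cantor} {μ : Measure Cantor} (hR : IsRepresentation R μ)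
    (k : ℕ) (σ : List Bool) {i : ℕ} (hi : i ≤ σ.length) :
    |(massApprox R k σ i : ℝ) - 2 ^ (k + 1) * μ.real (cylinder (σ.take i))| ≤ 2 * i := by
  have := hR.1
  induction i with
  | zero => simp [massApprox, cylinder_nil]
  | succ i ih =>
    have ih := ih (by omega)
    have hlt : i < σ.length := by omega
    obtain ⟨h1, h2⟩ := mant_le_columnValue R (σ.take i) k
    have hN : |(mant R (σ.take i) k : ℝ) - 2 ^ (k + 1) * columnValue R (σ.take i)| ≤ 2 := by
      rw [abs_le]
      constructor <;> linarith
    have hp : (0 : ℝ) ≤ 2 ^ (k + 1) := by positivity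
    rw [← List.take_concat_get' _ _ hlt, massApprox, List.getD_eq_getElem _ _ hlt]
    rw [Nat.cast_succ]
    cases σ[i] with
    | false =>
      rw [if_neg (by simp), hR.2, mul_min_of_nonneg _ _ hp]
      push_cast
      refine (abs_min_sub_min_le_max _ _ _ _).trans (max_le ?_ ?_) <;> linarith
    | true =>
      rw [if_pos rfl, measureReal_cylinder_true, hR.2]
      -- Both the truncated difference and the exact mass of the right half are put in the form `max
      -- (x - y) 0`, to which the Lipschitz bound applies.
      have e1 : ((massApprox R k σ i - mant R (σ.take i) k : ℕ) : ℝ) =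
          max ((massApprox R k σ i : ℝ) - mant R (σ.take i) k) 0 := by
        rcases le_total (mant R (σ.take i) k) (massApprox R k σ i) with h | h
        · rw [Nat.cast_sub h, max_eq_left (sub_nonneg.2 (by exact_mod_cast h))]
        · rw [Nat.sub_eq_zero_of_le h, max_eq_right (sub_nonpos.2 (by exact_mod_cast h)),
            Nat.cast_zero]
      have e2 : ∀ c m : ℝ, 2 ^ (k + 1) * (m - min c m) =
          max (2 ^ (k + 1) * m - 2 ^ (k + 1) * c) 0 := fun c m => by
        rw [← mul_sub, ← mul_zero ((2 : ℝ) ^ (k + 1)), ← mul_max_of_nonneg _ _ hp]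
        rcases le_total c m with h | h <;> simp [h]
      rw [e1, e2]
      refine (abs_max_sub_max_le_abs _ _ _).trans ?_
      rw [sub_sub_sub_comm]
      exact (abs_sub _ _).trans (by linarith)

/-- The summand `2 * σ.length` in the check absorbs the worst possible rounding error, so a positive
answer is never wrong. -/
theorem IsRepresentation.lt_of_massCheck {R : Cantor} {μ : Measure Cantor}
    (hR : IsRepresentation R μ) {σ : List Bool} {n k L : ℕ}
    (hL : Nat.pair (Encodable.encode σ) (2 * k) ≤ L) (h : massCheck (pre R L) σ n k = true) :
    μ.real (cylinder σ) < 2⁻¹ ^ n := by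
  rw [massCheck_pre hL] at h
  have h : ((massApprox R k σ σ.length : ℝ) + 2 * σ.length) * 2 ^ n < 2 ^ (k + 1) := by
    exact_mod_cast h
  have happ := abs_massApprox_sub_le hR k σ le_rfl
  rw [List.take_length] at happ
  have h1 : 2 ^ (k + 1) * μ.real (cylinder σ) ≤ massApprox R k σ σ.length + 2 * σ.length := by
    linarith [(abs_le.1 happ).1]
  have hp : (0 : ℝ) < 2 ^ (k + 1) := by positivity
  have hn : (0 : ℝ) < 2 ^ n := by positivity
  rw [inv_pow, ← one_div, lt_div_iff₀ hn]
  have h2 := (mul_le_mul_of_nonneg_right h1 hn.le).trans_lt h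
  rw [mul_assoc] at h2
  exact lt_of_mul_lt_mul_left (h2.trans_eq (mul_one _).symm) hp.le

/-- A strict inequality leaves a gap which, scaled by `2 ^ (k + 1)`, eventually exceeds the fixed
error `4 * σ.length * 2 ^ n`. -/
theorem IsRepresentation.eventually_massCheck {R : Cantor} {μ : Measure Cantor}
    (hR : IsRepresentation R μ) {σ : List Bool} {n : ℕ} (h : μ.real (cylinder σ) < 2⁻¹ ^ n) :
    ∀ᶠ k in Filter.atTop, ∀ L, Nat.pair (Encodable.encode σ) (2 * k) ≤ L →
      massCheck (pre R L) σ n k = true := by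
  have hn : (0 : ℝ) < 2 ^ n := by positivity
  rw [inv_pow, ← one_div, lt_div_iff₀ hn] at h
  have ht : Filter.Tendsto (fun k : ℕ => (2 : ℝ) ^ (k + 1)) Filter.atTop Filter.atTop :=
    (tendsto_pow_atTop_atTop_of_one_lt one_lt_two).comp (Filter.tendsto_add_atTop_nat 1)
  filter_upwards [(ht.atTop_mul_const (sub_pos.2 h)).eventually_gt_atTop
    ((4 * σ.length) * 2 ^ n)] with k hk L hL
  rw [massCheck_pre hL]
  have happ := abs_massApprox_sub_le hR k σ le_rfl
  rw [List.take_length] at happ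
  have h1 : massApprox R k σ σ.length + 2 * σ.length ≤
      2 ^ (k + 1) * μ.real (cylinder σ) + 4 * σ.length := by
    linarith [(abs_le.1 happ).2]
  have h2 := mul_le_mul_of_nonneg_right h1 hn.le
  have : ((massApprox R k σ σ.length : ℝ) + 2 * σ.length) * 2 ^ n < 2 ^ (k + 1) := by
    nlinarith
  exact_mod_cast this

/-- Every probability measure has a representation. -/
theorem exists_isRepresentation (μ : Measure Cantor) [IsProbabilityMeasure μ] :
    ∃ R, IsRepresentation R μ := by
  have hd : ∀ σ : List Bool, ∃ d : ℕ → Fin 2,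
      Real.ofDigits d = μ.real (cylinder (σ ++ [false])) := fun σ => by
    obtain ⟨d, -, hd⟩ := Real.ofDigits_SurjOn one_lt_two
      (show μ.real (cylinder (σ ++ [false])) ∈ Set.Icc (0 : ℝ) 1 from
        ⟨measureReal_nonneg, measureReal_le_one⟩)
    exact ⟨d, hd⟩
  choose d hd using hd
  -- Each binary digit is written as two equal bits, so it becomes a digit `0` or `2` one place
  -- further right.
  refine ⟨fun p => decide (d ((Encodable.decode p.unpair.1).getD []) (p.unpair.2 / 2) = 1),
    inferInstance, fun σ => ?_⟩
  have hcv : columnValue (fun p => decide (d ((Encodable.decode p.unpair.1).getD [])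
      (p.unpair.2 / 2) = 1)) σ = μ.real (cylinder (σ ++ [false])) := by
    rw [← hd σ, columnValue, Real.ofDigits]
    refine tsum_congr fun k => ?_
    simp only [Nat.unpair_pair, Encodable.encodek, Option.getD_some, Real.ofDigitsTerm,
      Nat.mul_div_cancel_left k two_pos, show (2 * k + 1) / 2 = k by omega]
    have hfin : ∀ x : Fin 2, (((decide (x = 1)).toNat : ℕ) : ℝ) = ((x : ℕ) : ℝ) := by
      intro x
      fin_cases x <;> simp
    rw [hfin]
    push_cast
    field_simp
    ring
  rw [hcv, min_eq_left]
  refine measureReal_mono fun X hX => ?_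
  exact (mem_cylinder_concat.1 hX).1

/-! ### Tests from compatible strings, and randomness relative to `A` -/

theorem exists_measureReal_cylinder_lt {μ : Measure Cantor} [IsProbabilityMeasure μ] {X : Cantor}
    (hX : ¬ IsAtomOf X μ) {ε : ℝ} (hε : 0 < ε) : ∃ m, μ.real (cylinder (pre X m)) < ε := by
  have hanti : Antitone fun m => cylinder (pre X m) := fun m n hmn Y hY =>
    mem_cylinder_pre.2 fun i hi => mem_cylinder_pre.1 hY i (hi.trans_le hmn)
  have hinter : ⋂ m, cylinder (pre X m) = {X} := by
    ext Y
    simp only [Set.mem_iInter, mem_cylinder_pre, Set.mem_singleton_iff]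
    exact ⟨fun h => funext fun i => h (i + 1) i i.lt_succ_self, fun h _ i _ => by rw [h]⟩
  have ht := tendsto_measure_iInter_atTop (μ := μ)
    (fun m => (measurableSet_cylinder (pre X m)).nullMeasurableSet) hanti ⟨0, measure_ne_top _ _⟩
  rw [hinter, nonpos_iff_eq_zero.1 (not_lt.1 hX)] at ht
  have ht' := (ENNReal.tendsto_toReal ENNReal.zero_ne_top).comp ht
  exact (ht'.eventually_lt_const hε).exists

theorem measure_le_of_measureReal_lt {α : Type*} [MeasurableSpace α] {μ : Measure α}
    [IsProbabilityMeasure μ] {s : Set α} {n : ℕ} (h : μ.real s < 2⁻¹ ^ n) :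
    μ s ≤ (2⁻¹ : ℝ≥0∞) ^ n := by
  rw [← ofReal_measureReal]
  refine (ENNReal.ofReal_le_ofReal h.le).trans_eq ?_
  rw [ENNReal.ofReal_pow (by norm_num), ENNReal.ofReal_inv_of_pos two_pos, ENNReal.ofReal_ofNat]

/-- A union of cylinders of measure at most `ε` along compatible strings has measure at most
`ε`. -/
theorem measure_le_of_compatible {μ : Measure Cantor} {ε : ℝ≥0∞} {G : List Bool → Prop}
    (hG : ∀ Y Y' m m', G (pre Y m) → G (pre Y' m') → ∀ i, i < m → i < m' → Y i = Y' i)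
    {S : Set Cantor} (hS : ∀ Y ∈ S, ∃ m, μ (cylinder (pre Y m)) ≤ ε ∧ G (pre Y m)) :
    μ S ≤ ε := by
  classical
  by_cases hex : ∃ m Y, μ (cylinder (pre Y m)) ≤ ε ∧ G (pre Y m)
  -- A shortest string that is both small and in `G`; by compatibility its cylinder contains all of
  -- `S`.
  · obtain ⟨Y₀, h₀, hG₀⟩ := Nat.find_spec hex
    refine (measure_mono fun Y hY => ?_).trans h₀
    obtain ⟨m, hm, hGm⟩ := hS Y hY
    exact mem_cylinder_pre.2 fun i hi =>
      hG _ _ _ _ hGm hG₀ i (hi.trans_le (Nat.find_min' hex ⟨Y, hm, hGm⟩)) hi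
  · have : S = ∅ := Set.eq_empty_of_forall_notMem fun Y hY => by
      obtain ⟨m, hm⟩ := hS Y hY
      exact hex ⟨m, Y, hm⟩
    simp [this]

theorem mem_MLR_of_isAtomOf {μ : Measure Cantor} [IsProbabilityMeasure μ] {A X : Cantor}
    (h : IsAtomOf X μ) : X ∈ MLR μ A := by
  obtain ⟨R, hR⟩ := exists_isRepresentation μ
  refine ⟨R, hR, fun V hV hX => h.ne' ?_⟩
  have hle : ∀ n, μ {X} ≤ (2⁻¹ : ℝ≥0∞) ^ n := fun n =>
    (measure_mono (Set.singleton_subset_iff.2 (Set.mem_iInter.1 hX n))).trans (hV.measure_le n)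
  exact nonpos_iff_eq_zero.1 (ge_of_tendsto'
    (ENNReal.tendsto_pow_atTop_nhds_zero_of_lt_one (by simp)) hle)

theorem isAtomOf_of_mem_MLR {μ : Measure Cantor} {A B : Cantor} (hAB : TuringLE B A)
    (hB : B ∈ MLR μ A) : IsAtomOf B μ := by
  by_contra hatom
  obtain ⟨R, hR, hB⟩ := hB
  have := hR.1
  obtain ⟨C, hC, hCcompat, hCB⟩ := hAB.exists_check
  -- The search variable codes a pair: the length of the oracle string from `A`, and a common bound
  -- for precision and running time. The factor `2` accounts for the join of `R` and `A`.
  let h : (ℕ × List Bool) × ℕ → ℕ := fun q =>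
    2 * (Nat.pair (Encodable.encode q.1.2) (2 * q.2.unpair.2) + q.2.unpair.1)
  let Q : List Bool × (ℕ × List Bool) × ℕ → Bool := fun q =>
    massCheck (evens q.1) q.2.1.2 q.2.1.1 q.2.2.unpair.2 &&
      C ((odds q.1).take q.2.2.unpair.1, q.2.2.unpair.2, q.2.1.2)
  have hh : Primrec h := Primrec.nat_mul.comp (Primrec.const 2) (Primrec.nat_add.comp
    (Primrec₂.natPair.comp (Primrec.encode.comp (Primrec.snd.comp Primrec.fst))
      (Primrec.nat_mul.comp (Primrec.const 2) (Primrec.snd.comp (Primrec.unpair.comp Primrec.snd))))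
    (Primrec.fst.comp (Primrec.unpair.comp Primrec.snd)))
  have hQ : Primrec Q := by
    have hk : Primrec fun q : List Bool × (ℕ × List Bool) × ℕ => q.2.2.unpair :=
      Primrec.unpair.comp (Primrec.snd.comp Primrec.snd)
    have hσ : Primrec fun q : List Bool × (ℕ × List Bool) × ℕ => q.2.1.2 :=
      Primrec.snd.comp (Primrec.fst.comp Primrec.snd)
    exact Primrec.and.comp
      (primrec_massCheck_comp (primrec_evens.comp Primrec.fst) hσ
        (Primrec.fst.comp (Primrec.fst.comp Primrec.snd)) (Primrec.snd.comp hk))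
      (hC.comp (Primrec.pair (Primrec.list_take.comp (Primrec.fst.comp hk)
        (primrec_odds.comp Primrec.fst)) (Primrec.pair (Primrec.snd.comp hk) hσ)))
  have hQiff : ∀ n σ k l, Q (pre (join R A) (h ((n, σ), Nat.pair l k)), (n, σ), Nat.pair l k) = true
      ↔ massCheck (pre R (Nat.pair (Encodable.encode σ) (2 * k) + l)) σ n k = true ∧
        C (pre A l, k, σ) = true := fun n σ k l => by
    simp only [Q, h, evens_pre, odds_pre, Nat.unpair_pair, Bool.and_eq_true,
      Nat.mul_div_cancel_left _ two_pos]
    rw [take_pre A (Nat.le_add_left _ _)]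
  let W : ℕ × List Bool → Prop := fun a => ∃ k, Q (pre (join R A) (h (a, k)), a, k) = true
  refine hB (fun n => {X | ∃ σ, W (n, σ) ∧ X ∈ cylinder σ}) ⟨⟨W,
    reIn_of_exists _ hh hQ fun _ => Iff.rfl, fun _ => rfl⟩, fun n => ?_⟩
    (Set.mem_iInter.2 fun n => ?_)
  · refine measure_le_of_compatible (G := fun τ => ∃ k l, C (pre A l, k, τ) = true)
      (fun Y Y' m m' ⟨_, _, h1⟩ ⟨_, _, h2⟩ => hCcompat _ _ _ _ _ _ _ _ _ h1 h2) ?_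
    rintro Y ⟨σ, ⟨p, hp⟩, hY⟩
    rw [← Nat.pair_unpair p, hQiff] at hp
    rw [mem_cylinder_iff] at hY
    refine ⟨σ.length, ?_⟩
    rw [hY]
    exact ⟨measure_le_of_measureReal_lt (hR.lt_of_massCheck (Nat.le_add_right _ _) hp.1),
      _, _, hp.2⟩
  · obtain ⟨m, hm⟩ := exists_measureReal_cylinder_lt hatom (ε := 2⁻¹ ^ n) (by positivity)
    obtain ⟨l, -, hl⟩ := hCB m
    obtain ⟨k, hk1, hk2⟩ := (hl.and (hR.eventually_massCheck hm)).exists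
    exact ⟨pre B m, ⟨Nat.pair l k, (hQiff _ _ _ _).2 ⟨hk2 _ (Nat.le_add_right _ _), hk1⟩⟩,
      mem_cylinder_pre.2 fun _ _ => rfl⟩

/-! ### Randomness of pairs -/

theorem measurable_join : Measurable fun q : Cantor × Cantor => join q.1 q.2 := by
  refine measurable_pi_iff.2 fun n => ?_
  by_cases hn : n % 2 = 0
  · simp only [join, if_pos hn]
    exact (measurable_pi_apply (n / 2)).comp measurable_fst
  · simp only [join, if_neg hn]
    exact (measurable_pi_apply (n / 2)).comp measurable_snd

theorem map_join_prod_cylinder_dbl (μ : Measure Cantor) [IsProbabilityMeasure μ] (X : Cantor)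
    (m : ℕ) : ((μ.prod μ).map fun q => join q.1 q.2).real (cylinder (dbl (pre X m))) =
      μ.real (cylinder (pre X m)) ^ 2 := by
  have hpre : (fun q : Cantor × Cantor => join q.1 q.2) ⁻¹' cylinder (dbl (pre X m)) =
      cylinder (pre X m) ×ˢ cylinder (pre X m) := by
    ext ⟨Y, Z⟩
    simp only [Set.mem_preimage, Set.mem_prod, dbl_pre, mem_cylinder_pre]
    refine ⟨fun h => ⟨fun i hi => ?_, fun i hi => ?_⟩, fun h i hi => ?_⟩
    · simpa only [join_even] using h (2 * i) (by omega)
    · simpa only [join_odd] using h (2 * i + 1) (by omega)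
    · simp only [join, h.1 (i / 2) (by omega), h.2 (i / 2) (by omega)]
  rw [map_measureReal_apply measurable_join (measurableSet_cylinder _), hpre,
    measureReal_prod_prod, sq]

theorem isAtomOf_of_mem_pairMLR {μ : Measure Cantor} [IsProbabilityMeasure μ] {A B : Cantor}
    (hAB : TuringLE B A) (hpair : (A, B) ∈ pairMLR (μ.prod μ)) : IsAtomOf B μ := by
  by_contra hatom
  obtain ⟨R, hR, hrandom⟩ := hpair
  obtain ⟨C, hC, hCcompat, hCB⟩ := hAB.exists_check
  let h : (ℕ × List Bool) × ℕ → ℕ := fun q =>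
    2 * Nat.pair (Encodable.encode (dbl ((odds q.1.2).take q.2.unpair.1))) (2 * q.2.unpair.2)
  -- The exponent is `2 * n` because the mass tested is a square. The length condition ensures that
  -- the truncated odd part really has the requested length.
  let Q : List Bool × (ℕ × List Bool) × ℕ → Bool := fun q =>
    (massCheck (evens q.1) (dbl ((odds q.2.1.2).take q.2.2.unpair.1)) (2 * q.2.1.1)
      q.2.2.unpair.2 && decide (q.2.2.unpair.1 ≤ q.2.1.2.length / 2)) &&
      C (evens q.2.1.2, q.2.2.unpair.2, (odds q.2.1.2).take q.2.2.unpair.1)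
  have hh : Primrec h := Primrec.nat_mul.comp (Primrec.const 2) (Primrec₂.natPair.comp
    (Primrec.encode.comp (primrec_dbl.comp (Primrec.list_take.comp
      (Primrec.fst.comp (Primrec.unpair.comp Primrec.snd))
      (primrec_odds.comp (Primrec.snd.comp Primrec.fst)))))
    (Primrec.nat_mul.comp (Primrec.const 2) (Primrec.snd.comp (Primrec.unpair.comp Primrec.snd))))
  have hQ : Primrec Q := by
    have hk : Primrec fun q : List Bool × (ℕ × List Bool) × ℕ => q.2.2.unpair :=
      Primrec.unpair.comp (Primrec.snd.comp Primrec.snd)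
    have hσ : Primrec fun q : List Bool × (ℕ × List Bool) × ℕ => q.2.1.2 :=
      Primrec.snd.comp (Primrec.fst.comp Primrec.snd)
    have hτ : Primrec fun q : List Bool × (ℕ × List Bool) × ℕ =>
        (odds q.2.1.2).take q.2.2.unpair.1 :=
      Primrec.list_take.comp (Primrec.fst.comp hk) (primrec_odds.comp hσ)
    have hdbl : Primrec fun q : List Bool × (ℕ × List Bool) × ℕ =>
        dbl ((odds q.2.1.2).take q.2.2.unpair.1) := primrec_dbl.comp hτ
    have hn : Primrec fun q : List Bool × (ℕ × List Bool) × ℕ => 2 * q.2.1.1 :=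
      Primrec.nat_mul.comp (Primrec.const 2) (Primrec.fst.comp (Primrec.fst.comp Primrec.snd))
    have hmass : Primrec fun q : List Bool × (ℕ × List Bool) × ℕ =>
        massCheck (evens q.1) (dbl ((odds q.2.1.2).take q.2.2.unpair.1)) (2 * q.2.1.1)
          q.2.2.unpair.2 :=
      primrec_massCheck_comp (primrec_evens.comp Primrec.fst) hdbl hn (Primrec.snd.comp hk)
    have hle : Primrec fun q : List Bool × (ℕ × List Bool) × ℕ =>
        decide (q.2.2.unpair.1 ≤ q.2.1.2.length / 2) :=
      (Primrec.nat_le.comp (Primrec.fst.comp hk)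
        (Primrec.nat_div.comp (Primrec.list_length.comp hσ) (Primrec.const 2))).decide
    have hfun : Primrec fun q : List Bool × (ℕ × List Bool) × ℕ =>
        C (evens q.2.1.2, q.2.2.unpair.2, (odds q.2.1.2).take q.2.2.unpair.1) :=
      hC.comp (Primrec.pair (primrec_evens.comp hσ) (Primrec.pair (Primrec.snd.comp hk) hτ))
    exact Primrec.and.comp (Primrec.and.comp hmass hle) hfun
  have hQiff : ∀ n X Y l m k, Q (pre (join R emptyReal)
        (h ((n, pre (join X Y) l), Nat.pair m k)), (n, pre (join X Y) l), Nat.pair m k) = true ↔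
      m ≤ l / 2 ∧ massCheck (pre R (Nat.pair (Encodable.encode (dbl (pre Y m))) (2 * k)))
        (dbl (pre Y m)) (2 * n) k = true ∧ C (pre X (l / 2), k, pre Y m) = true := by
    intro n X Y l m k
    simp only [Q, h, evens_pre, odds_pre, Nat.unpair_pair, Bool.and_eq_true, length_pre,
      Nat.mul_div_cancel_left _ two_pos, decide_eq_true_eq]
    by_cases hm : m ≤ l / 2
    · simp only [take_pre Y hm, hm, true_and, and_true]
    · simp only [hm, false_and, and_false]
  let W : ℕ × List Bool → Prop := fun a => ∃ k, Q (pre (join R emptyReal) (h (a, k)), a, k) = true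
  refine hrandom (fun n => {X | ∃ σ, W (n, σ) ∧ X ∈ cylinder σ}) ⟨⟨W,
    reIn_of_exists _ hh hQ fun _ => Iff.rfl, fun _ => rfl⟩, fun n => ?_⟩
    (Set.mem_iInter.2 fun n => ?_)
  · have hV : MeasurableSet {X | ∃ σ, W (n, σ) ∧ X ∈ cylinder σ} := by
      have : {X | ∃ σ, W (n, σ) ∧ X ∈ cylinder σ} = ⋃ σ ∈ {σ | W (n, σ)}, cylinder σ := by
        ext X
        simp
      rw [this]
      exact MeasurableSet.biUnion (Set.to_countable _) fun σ _ => measurableSet_cylinder σ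
    -- Fubini: it suffices to bound each section, where `X` is fixed and the strings computed from
    -- it are compatible.
    rw [Measure.map_apply measurable_join hV, Measure.prod_apply (measurable_join hV)]
    refine (lintegral_mono (g := fun _ => (2⁻¹ : ℝ≥0∞) ^ n) fun X => ?_).trans_eq (by simp)
    refine measure_le_of_compatible (G := fun τ => ∃ k l, C (pre X l, k, τ) = true)
      (fun Y Y' m m' ⟨_, _, h1⟩ ⟨_, _, h2⟩ => hCcompat _ _ _ _ _ _ _ _ _ h1 h2) ?_
    rintro Y ⟨ρ, ⟨p, hp⟩, hY⟩
    have hY : pre (join X Y) ρ.length = ρ := mem_cylinder_iff.1 hY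
    rw [← Nat.pair_unpair p, ← hY, hQiff] at hp
    refine ⟨p.unpair.1, measure_le_of_measureReal_lt ?_, _, _, hp.2.2⟩
    have hlt := hR.lt_of_massCheck le_rfl hp.2.1
    rw [map_join_prod_cylinder_dbl, mul_comm, pow_mul] at hlt
    exact lt_of_pow_lt_pow_left₀ 2 (by positivity) hlt
  · obtain ⟨m, hm⟩ := exists_measureReal_cylinder_lt hatom (ε := 2⁻¹ ^ n) (by positivity)
    obtain ⟨l, hml, hl⟩ := hCB m
    have hm' : ((μ.prod μ).map fun q => join q.1 q.2).real (cylinder (dbl (pre B m))) <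
        2⁻¹ ^ (2 * n) := by
      rw [map_join_prod_cylinder_dbl, mul_comm, pow_mul]
      exact pow_lt_pow_left₀ hm measureReal_nonneg two_ne_zero
    obtain ⟨k, hk1, hk2⟩ := (hl.and (hR.eventually_massCheck hm')).exists
    have hl2 : 2 * l / 2 = l := by omega
    -- Length `2 * l` yields `l` bits of `A`, enough for the computation, and `l ≥ m` bits of `B`.
    exact ⟨pre (join A B) (2 * l), ⟨Nat.pair m k, (hQiff _ _ _ _ _ _).2
      ⟨by rwa [hl2], hk2 _ le_rfl, by rwa [hl2]⟩⟩, mem_cylinder_pre.2 fun _ _ => rfl⟩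

end RelRandom


theorem mainTheorem9 (μ : MeasureTheory.Measure RelRandom.Cantor)
    [MeasureTheory.IsProbabilityMeasure μ] (A B : RelRandom.Cantor)
    (hAB : RelRandom.TuringLE B A) :
    ((A, B) ∈ RelRandom.pairMLR (μ.prod μ) → RelRandom.IsAtomOf B μ) ∧
      (B ∈ RelRandom.MLR μ A ↔ RelRandom.IsAtomOf B μ) :=
  ⟨RelRandom.isAtomOf_of_mem_pairMLR hAB, RelRandom.isAtomOf_of_mem_MLR hAB,
    RelRandom.mem_MLR_of_isAtomOf⟩
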